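/- Let $p$ be a prime and let $G$ be a finite group that is the mutually permutable product of two subgroups $A$ and $B$; that is, $G=AB$, and $UB=BU$ and $AV=VA$ for all subgroups $U\le A$ and $V\le B$. Suppose that $A$ and $B$ are $p$-supersoluble, where a finite group is called $p$-supersoluble if each of its chief factors of order divisible by $p$ has order exactly $p$. Call a finite group $p$-nilpotent if it has a normal subgroup of order prime to $p$ whose quotient is a $p$-group. For a class $\mathfrak F$ of groups, the $\mathfrak F$-residual $X^{\mathfrak F}$ of a finite group $X$ is the smallest normal subgroup of $X$ with quotient in $\mathfrak F$. Let $p\mathfrak U$ be the class of finite $p$-supersoluble groups and let $\mathfrak E_{p'}\mathfrak N_p$ be the class of finite $p$-nilpotent groups. Then the residuals below exist and $$G^{p\mathfrak U}=(G')^{\mathfrak E_{p'}\mathfrak N_p}=[A,B]^{\mathfrak E_{p'}\mathfrak N_p},$$ where $G'$ is the derived subgroup of $G$ and $[A,B]=\langle [a,b] : a\in A,\ b\in B\rangle$. -/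

import Mathlib

open scoped Pointwise

universe u

/-- `G = AB` is the mutually permutable product of its subgroups `A` and `B`:
`UB = BU` and `AV = VA` for all subgroups `U ≤ A` and `V ≤ B`. -/
structure IsMutuallyPermutableProduct {G : Type u} [Group G] (A B : Subgroup G) : Prop where
  mul_eq_univ : (A : Set G) * (B : Set G) = Set.univ
  left_permutes : ∀ U : Subgroup G, U ≤ A → (U : Set G) * (B : Set G) = (B : Set G) * (U : Set G)
  right_permutes : ∀ V : Subgroup G, V ≤ B → (A : Set G) * (V : Set G) = (V : Set G) * (A : Set G)

/-- `H / K` is a chief factor of `G`: `K < H` are normal subgroups of `G`, and no normal subgroup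
of `G` lies strictly between them. -/
structure IsChiefFactor {G : Type u} [Group G] (K H : Subgroup G) : Prop where
  normal_bot : K.Normal
  normal_top : H.Normal
  lt : K < H
  eq_or_eq : ∀ N : Subgroup G, N.Normal → K ≤ N → N ≤ H → N = K ∨ N = H

/-- A (finite) group is `p`-supersoluble if each of its chief factors whose order is divisible
by `p` has order exactly `p`. The order of `H / K` is the index `K.relIndex H` of `K` in `H`. -/
def IsPSupersoluble (p : ℕ) (G : Type u) [Group G] : Prop :=
  ∀ K H : Subgroup G, IsChiefFactor K H → p ∣ K.relIndex H → K.relIndex H = p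

/-- A (finite) group is `p`-nilpotent if it has a normal `p'`-subgroup whose quotient is
a `p`-group. -/
def IsPNilpotent (p : ℕ) (G : Type u) [Group G] : Prop :=
  ∃ (K : Subgroup G) (_ : K.Normal), ¬ p ∣ Nat.card K ∧ IsPGroup p (G ⧸ K)

/-- `R` is the `𝔉`-residual of `G`: the smallest normal subgroup of `G` with quotient in `𝔉`. -/
def IsResidual (𝔉 : ∀ (X : Type u) [Group X], Prop) {G : Type u} [Group G]
    (R : Subgroup G) : Prop :=
  ∃ _ : R.Normal, 𝔉 (G ⧸ R) ∧ ∀ (N : Subgroup G) (_ : N.Normal), 𝔉 (G ⧸ N) → R ≤ N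

/-- The `p`-nilpotent groups are the formation product of the `p'`-groups and the `p`-groups:
the groups whose `p`-group residual is a `p'`-group. -/
theorem isPNilpotent_iff_residual {p : ℕ} [Fact p.Prime] {G : Type u} [Group G] [Finite G] :
    IsPNilpotent p G ↔
      ∃ R : Subgroup G, IsResidual (fun X _ => IsPGroup p X) R ∧ ¬ p ∣ Nat.card R := by
  constructor
  · rintro ⟨K, hK, hc, hq⟩
    refine ⟨K, ⟨hK, hq, fun N hN h x hx => ?_⟩, hc⟩
    obtain ⟨k, hk⟩ := h (QuotientGroup.mk x)
    have h1 : orderOf (QuotientGroup.mk x : G ⧸ N) ∣ p ^ k := orderOf_dvd_of_pow_eq_one hk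
    have h2 : orderOf (QuotientGroup.mk x : G ⧸ N) ∣ Nat.card K :=
      (orderOf_map_dvd (QuotientGroup.mk' N) x).trans (K.orderOf_dvd_natCard hx)
    have h3 : Nat.Coprime (p ^ k) (Nat.card K) :=
      (((Fact.out : p.Prime).coprime_iff_not_dvd).2 hc).pow_left k
    have h4 := Nat.eq_one_of_dvd_coprimes h3 h1 h2
    exact (QuotientGroup.eq_one_iff x).1 (orderOf_eq_one_iff.1 h4)
  · rintro ⟨R, ⟨hR, hq, -⟩, hc⟩
    exact ⟨R, hR, hc, hq⟩

/-!
Both classes contain the trivial groups and are closed under subdirect products, so the residuals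
exist. Write `R`, `S`, `T` for the `p`-supersoluble residual of `G` and the `p`-nilpotent residuals
of `G'` and `[A, B]`. A `p`-supersoluble group has `p`-nilpotent derived subgroup, since commutators
centralise chief factors of order `p` (`IsPSupersoluble.isPNilpotent_commutator`); applied to
`G ⧸ R` this gives `S ≤ R`. As `[A, B] ≤ G'`, also `T ≤ S`.

For `R ≤ T` one passes to `G ⧸ T`, where `T` is normal in `G` as a characteristic subgroup of
`[A, B] ⊴ G`. This leaves the assertion that `G` is `p`-supersoluble if `[A, B]` is `p`-nilpotent
(`IsMutuallyPermutableProduct.isPSupersoluble`). By induction on `|G|` the essential case is a minimal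
normal subgroup `N` of `G` in the centre of the `p`-group `[A, B]`, which must be shown to have
order `p`. Mutual permutability enters here: together with the `p`-supersolubility of both factors it
yields subgroups of order `p` in `N`, one normalised by `A` and one by `B`
(`IsMutuallyPermutableProduct.exists_invariant_card_eq`). Since `A` and `B` induce commuting groups of
automorphisms on `N`, a Clifford-type argument shows that `A` acts on `N` by powers
(`IsMutuallyPermutableProduct.exists_conj_eq_zpow`). Hence the subgroup of order `p` normalised by `B`
is normal in `G` and equals `N`.
-/

/-! ### Chief factors and `p`-supersoluble groups -/

section ChiefFactors

variable {G : Type u} [Group G] {K H N : Subgroup G}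

theorem IsChiefFactor.inf_sup_eq (h : IsChiefFactor K H) (hN : N.Normal) (hle : ¬ H ⊓ N ≤ K) :
    H ⊓ N ⊔ K = H := by
  have := h.normal_bot
  have := h.normal_top
  rcases h.eq_or_eq (H ⊓ N ⊔ K) inferInstance le_sup_right (sup_le inf_le_left h.lt.le) with h1 | h1
  · exact absurd (le_sup_left.trans h1.le) hle
  · exact h1

/-- If a normal subgroup `N` avoids the chief factor `H / K`, then `HN / KN` is a chief factor of
the same order. -/
theorem IsChiefFactor.sup (h : IsChiefFactor K H) (hN : N.Normal) (hle : H ⊓ N ≤ K) :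
    IsChiefFactor (K ⊔ N) (H ⊔ N) ∧ (K ⊔ N).relIndex (H ⊔ N) = K.relIndex H := by
  have hK := h.normal_bot
  have hH := h.normal_top
  have hcap : (K ⊔ N) ⊓ H = K := by
    refine le_antisymm ?_ (le_inf le_sup_left h.lt.le)
    rintro x ⟨hx, hxH⟩
    obtain ⟨k, hk, n, hn, rfl⟩ := Subgroup.mem_sup_of_normal_right.1 hx
    exact K.mul_mem hk (hle ⟨(H.mul_mem_cancel_left (h.lt.le hk)).1 hxH, hn⟩)
  have hidx : (K ⊔ N).relIndex (H ⊔ N) = K.relIndex H := by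
    have h1 : H ⊔ N = H ⊔ (K ⊔ N) := by
      rw [← sup_assoc, sup_eq_left.2 h.lt.le]
    rw [h1, Subgroup.relIndex_sup_right, ← Subgroup.inf_relIndex_right, hcap]
  refine ⟨⟨inferInstance, inferInstance, ?_, fun L hL hKL hLH => ?_⟩, hidx⟩
  · refine lt_of_le_of_ne (sup_le_sup_right h.lt.le N) fun he => ?_
    rw [he, Subgroup.relIndex_self] at hidx
    exact h.lt.not_ge (Subgroup.relIndex_eq_one.1 hidx.symm)
  · rcases h.eq_or_eq (L ⊓ H) inferInstance (le_inf (le_sup_left.trans hKL) h.lt.le)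
      inf_le_right with h1 | h1
    · left
      refine le_antisymm (fun x hx => ?_) hKL
      obtain ⟨y, hy, n, hn, rfl⟩ := Subgroup.mem_sup_of_normal_right.1 (hLH hx)
      have hy' : y ∈ L ⊓ H :=
        ⟨(L.mul_mem_cancel_right (hKL (Subgroup.mem_sup_right hn))).1 hx, hy⟩
      exact Subgroup.mul_mem_sup (h1.le hy') hn
    · exact Or.inr (le_antisymm hLH (sup_le (h1.ge.trans inf_le_left) (le_sup_right.trans hKL)))

/-- If a normal subgroup `N` covers the chief factor `H / K`, then `(H ∩ N) / (K ∩ N)` is a chief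
factor of the same order. -/
theorem IsChiefFactor.inf (h : IsChiefFactor K H) (hN : N.Normal) (hle : ¬ H ⊓ N ≤ K) :
    IsChiefFactor (K ⊓ N) (H ⊓ N) ∧ (K ⊓ N).relIndex (H ⊓ N) = K.relIndex H := by
  have hK := h.normal_bot
  have hH := h.normal_top
  have hsup := h.inf_sup_eq hN hle
  have hcap : K ⊓ (H ⊓ N) = K ⊓ N := by rw [← inf_assoc, inf_eq_left.2 h.lt.le]
  refine ⟨⟨inferInstance, inferInstance, ?_, fun L hL hKL hLH => ?_⟩, ?_⟩
  · exact lt_of_le_of_ne (inf_le_inf_right N h.lt.le) fun he => hle (he.ge.trans inf_le_left)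
  · rcases h.eq_or_eq (L ⊔ K) inferInstance le_sup_right
      (sup_le (hLH.trans inf_le_left) h.lt.le) with h1 | h1
    · exact Or.inl (le_antisymm (le_inf (le_sup_left.trans h1.le) (hLH.trans inf_le_right)) hKL)
    · refine Or.inr (le_antisymm hLH fun x hx => ?_)
      obtain ⟨l, hl, k, hk, rfl⟩ := Subgroup.mem_sup_of_normal_right.1 (h1.ge hx.1)
      exact L.mul_mem hl (hKL ⟨hk, (N.mul_mem_cancel_left (hLH hl).2).1 hx.2⟩)
  · rw [← hcap, Subgroup.inf_relIndex_right, ← Subgroup.relIndex_sup_right (H ⊓ N) K, hsup]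

theorem IsChiefFactor.comap {G' : Type*} [Group G'] {f : G →* G'}
    (hf : Function.Surjective f) {K H : Subgroup G'} (h : IsChiefFactor K H) :
    IsChiefFactor (K.comap f) (H.comap f) ∧
      (K.comap f).relIndex (H.comap f) = K.relIndex H := by
  have hK := h.normal_bot
  have hH := h.normal_top
  refine ⟨⟨inferInstance, inferInstance, (Subgroup.comap_lt_comap_of_surjective hf).2 h.lt,
    fun L hL hKL hLH => ?_⟩, ?_⟩
  · have hL' : L = (L.map f).comap f := by
      rw [Subgroup.comap_map_eq, left_eq_sup, ← MonoidHom.comap_bot]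
      exact (Subgroup.comap_mono bot_le).trans hKL
    rcases h.eq_or_eq (L.map f) (hL.map f hf)
      ((Subgroup.comap_le_comap_of_surjective hf).1 (hKL.trans hL'.le))
      ((Subgroup.comap_le_comap_of_surjective hf).1 (hL'.ge.trans hLH)) with h1 | h1
    · exact Or.inl (h1 ▸ hL')
    · exact Or.inr (h1 ▸ hL')
  · rw [Subgroup.relIndex_comap, Subgroup.map_comap_eq_self_of_surjective hf]

theorem IsChiefFactor.map {G' : Type*} [Group G'] {f : G →* G'}
    (hf : Function.Surjective f) (h : IsChiefFactor K H) (hker : f.ker ≤ K) :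
    IsChiefFactor (K.map f) (H.map f) ∧ (K.map f).relIndex (H.map f) = K.relIndex H := by
  have hK := h.normal_bot
  have hH := h.normal_top
  have hKc : (K.map f).comap f = K := by rw [Subgroup.comap_map_eq, sup_eq_left.2 hker]
  have hHc : (H.map f).comap f = H := by
    rw [Subgroup.comap_map_eq, sup_eq_left.2 (hker.trans h.lt.le)]
  refine ⟨⟨hK.map f hf, hH.map f hf, ?_, fun L hL hKL hLH => ?_⟩, ?_⟩
  · rw [← Subgroup.comap_lt_comap_of_surjective hf, hKc, hHc]
    exact h.lt
  · rcases h.eq_or_eq (L.comap f) inferInstance (hKc.ge.trans (Subgroup.comap_mono hKL))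
      ((Subgroup.comap_mono hLH).trans hHc.le) with h1 | h1
    · left; rw [← h1, Subgroup.map_comap_eq_self_of_surjective hf]
    · right; rw [← h1, Subgroup.map_comap_eq_self_of_surjective hf]
  · rw [← Subgroup.relIndex_comap, hKc]

theorem exists_minimal_normal [Finite G] (hN : N.Normal) (hne : N ≠ ⊥) :
    ∃ M ≤ N, IsChiefFactor ⊥ M := by
  obtain ⟨M, hMN, hM⟩ := Set.Finite.exists_le_minimal
    (s := {M : Subgroup G | M.Normal ∧ M ≠ ⊥}) (Set.toFinite _) ⟨hN, hne⟩
  refine ⟨M, hMN, inferInstance, hM.prop.1, bot_lt_iff_ne_bot.2 hM.prop.2, fun L hL _ hLM => ?_⟩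
  by_cases hb : L = ⊥
  · exact Or.inl hb
  · exact Or.inr (le_antisymm hLM (hM.le_of_le ⟨hL, hb⟩ hLM))

end ChiefFactors

section PSupersoluble

variable {p : ℕ} {G : Type u} [Group G]

theorem IsPSupersoluble.of_surjective {G' : Type*} [Group G'] (h : IsPSupersoluble p G)
    (f : G →* G') (hf : Function.Surjective f) : IsPSupersoluble p G' := by
  intro K H hKH hd
  obtain ⟨h1, h2⟩ := hKH.comap hf
  rw [← h2] at hd ⊢
  exact h _ _ h1 hd

/-- The chief factors of `G` above `N` are those of `G ⧸ N`. -/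
theorem isPSupersoluble_quotient_iff {N : Subgroup G} [N.Normal] :
    IsPSupersoluble p (G ⧸ N) ↔
      ∀ K H : Subgroup G, IsChiefFactor K H → N ≤ K → p ∣ K.relIndex H → K.relIndex H = p := by
  constructor
  · intro h K H hKH hN hd
    obtain ⟨h1, h2⟩ := hKH.map (QuotientGroup.mk'_surjective N) (by simpa using hN)
    rw [← h2] at hd ⊢
    exact h _ _ h1 hd
  · intro h K H hKH hd
    obtain ⟨h1, h2⟩ := hKH.comap (QuotientGroup.mk'_surjective N)
    rw [← h2] at hd ⊢
    exact h _ _ h1 (QuotientGroup.le_comap_mk' N K) hd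

/-- The class of `p`-supersoluble groups is closed under subdirect products: a chief factor
covered by `M` is isomorphic to one below `M`, which `N` avoids. -/
theorem IsPSupersoluble.quotient_inf {M N : Subgroup G} [M.Normal] [hN : N.Normal]
    (hM' : IsPSupersoluble p (G ⧸ M)) (hN' : IsPSupersoluble p (G ⧸ N)) :
    IsPSupersoluble p (G ⧸ M ⊓ N) := by
  rw [isPSupersoluble_quotient_iff] at *
  intro K H h hle hd
  by_cases hc : H ⊓ M ≤ K
  · obtain ⟨h1, h2⟩ := h.sup ‹_› hc
    rw [← h2] at hd ⊢
    exact hM' _ _ h1 le_sup_right hd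
  · obtain ⟨h1, h2⟩ := h.inf ‹_› hc
    obtain ⟨h3, h4⟩ := h1.sup hN
      (le_inf (le_trans (inf_le_inf_right N inf_le_right) hle) (inf_le_left.trans inf_le_right))
    rw [← h2, ← h4] at hd ⊢
    exact hN' _ _ h3 le_sup_right hd

/-- A chief factor covered by `N` has order dividing that of `N`. -/
theorem IsPSupersoluble.of_quotient [Fact p.Prime] {N : Subgroup G} [hN : N.Normal]
    (h : IsPSupersoluble p (G ⧸ N)) (hc : Nat.card N = p ∨ ¬ p ∣ Nat.card N) :
    IsPSupersoluble p G := by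
  rw [isPSupersoluble_quotient_iff] at h
  intro K H hKH hd
  by_cases hle : H ⊓ N ≤ K
  · obtain ⟨h1, h2⟩ := hKH.sup ‹_› hle
    rw [← h2] at hd ⊢
    exact h _ _ h1 le_sup_right hd
  · obtain ⟨h1, h2⟩ := hKH.inf hN hle
    have h3 : K.relIndex H ∣ Nat.card N :=
      h2 ▸ (Subgroup.relIndex_dvd_card _ _).trans (Subgroup.card_dvd_of_le inf_le_right)
    rcases hc with hc | hc
    · exact Nat.dvd_antisymm (hc ▸ h3) hd
    · exact absurd (hd.trans h3) hc

theorem IsPSupersoluble.card_eq_or (h : IsPSupersoluble p G) {N : Subgroup G}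
    (hN : IsChiefFactor ⊥ N) : Nat.card N = p ∨ ¬ p ∣ Nat.card N := by
  have := h _ _ hN
  rw [Subgroup.relIndex_bot_left] at this
  tauto

end PSupersoluble

/-! ### `p`-nilpotent groups -/

section PNilpotent

variable {p : ℕ} {G : Type u} [Group G]

theorem isPNilpotent_iff : IsPNilpotent p G ↔
    ∃ K : Subgroup G, K.Normal ∧ ¬ p ∣ Nat.card K ∧ ∀ g : G, ∃ k : ℕ, g ^ p ^ k ∈ K := by
  constructor
  · rintro ⟨K, hK, hc, hq⟩
    refine ⟨K, hK, hc, fun g => ?_⟩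
    obtain ⟨k, hk⟩ := hq (g : G ⧸ K)
    exact ⟨k, (QuotientGroup.eq_one_iff _).1 hk⟩
  · rintro ⟨K, hK, hc, hq⟩
    refine ⟨K, hK, hc, fun x => ?_⟩
    obtain ⟨g, rfl⟩ := QuotientGroup.mk_surjective x
    obtain ⟨k, hk⟩ := hq g
    exact ⟨k, (QuotientGroup.eq_one_iff _).2 hk⟩

theorem IsPNilpotent.of_injective {G' : Type*} [Group G'] (h : IsPNilpotent p G')
    (f : G →* G') (hf : Function.Injective f) : IsPNilpotent p G := by
  rw [isPNilpotent_iff] at *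
  obtain ⟨K, hK, hc, hq⟩ := h
  refine ⟨K.comap f, inferInstance, fun hd => hc (hd.trans ?_), fun g => ?_⟩
  · rw [Nat.card_congr ((K.comap f).equivMapOfInjective f hf).toEquiv]
    exact Subgroup.card_dvd_of_le (Subgroup.map_comap_le f K)
  · obtain ⟨k, hk⟩ := hq (f g)
    exact ⟨k, by simpa using hk⟩

theorem IsPNilpotent.of_surjective {G' : Type*} [Group G'] (h : IsPNilpotent p G)
    (f : G →* G') (hf : Function.Surjective f) : IsPNilpotent p G' := by
  rw [isPNilpotent_iff] at *
  obtain ⟨K, hK, hc, hq⟩ := h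
  refine ⟨K.map f, hK.map f hf, fun hd => hc (hd.trans (Subgroup.card_map_dvd K f)), fun g => ?_⟩
  obtain ⟨g, rfl⟩ := hf g
  obtain ⟨k, hk⟩ := hq g
  exact ⟨k, _, hk, map_pow f g _⟩

theorem IsPNilpotent.prod [hp : Fact p.Prime] {G' : Type*} [Group G'] (h : IsPNilpotent p G)
    (h' : IsPNilpotent p G') : IsPNilpotent p (G × G') := by
  rw [isPNilpotent_iff] at *
  obtain ⟨K, hK, hc, hq⟩ := h
  obtain ⟨K', hK', hc', hq'⟩ := h'
  refine ⟨K.prod K', inferInstance, ?_, fun ⟨g, g'⟩ => ?_⟩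
  · rw [Nat.card_congr (K.prodEquiv K').toEquiv, Nat.card_prod, hp.out.dvd_mul]
    tauto
  · obtain ⟨k, hk⟩ := hq g
    obtain ⟨l, hl⟩ := hq' g'
    refine ⟨k + l, ?_, ?_⟩
    · change g ^ p ^ (k + l) ∈ K
      rw [pow_add, pow_mul]
      exact K.pow_mem hk _
    · change g' ^ p ^ (k + l) ∈ K'
      rw [add_comm, pow_add, pow_mul]
      exact K'.pow_mem hl _

theorem IsPNilpotent.quotient_ker {G' : Type*} [Group G'] (h : IsPNilpotent p G')
    (f : G →* G') : IsPNilpotent p (G ⧸ f.ker) :=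
  h.of_injective _ (QuotientGroup.kerLift_injective f)

theorem isPNilpotent_quotient_congr {M N : Subgroup G} [M.Normal] [N.Normal] (hMN : M = N) :
    IsPNilpotent p (G ⧸ M) ↔ IsPNilpotent p (G ⧸ N) := by
  subst hMN
  rfl

theorem IsPNilpotent.quotient_inf [Fact p.Prime] {M N : Subgroup G} [M.Normal] [N.Normal]
    (hM : IsPNilpotent p (G ⧸ M)) (hN : IsPNilpotent p (G ⧸ N)) : IsPNilpotent p (G ⧸ M ⊓ N) := by
  have h := (hM.prod hN).quotient_ker ((QuotientGroup.mk' M).prod (QuotientGroup.mk' N))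
  refine (isPNilpotent_quotient_congr ?_).1 h
  rw [MonoidHom.ker_prod, QuotientGroup.ker_mk', QuotientGroup.ker_mk']

theorem IsPNilpotent.of_ker_coprime [hp : Fact p.Prime] [Finite G] {G' : Type*} [Group G']
    (h : IsPNilpotent p G') (f : G →* G') (hf : ¬ p ∣ Nat.card f.ker) : IsPNilpotent p G := by
  rw [isPNilpotent_iff] at *
  obtain ⟨K, hK, hc, hq⟩ := h
  refine ⟨K.comap f, inferInstance, fun hd => ?_, fun g => ?_⟩
  · have hle : f.ker ≤ K.comap f := by
      rw [← MonoidHom.comap_bot]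
      exact Subgroup.comap_mono bot_le
    rw [← Subgroup.relIndex_bot_left, ← Subgroup.relIndex_mul_relIndex ⊥ _ _ bot_le hle,
      Subgroup.relIndex_bot_left, Subgroup.relIndex_ker, hp.out.dvd_mul] at hd
    exact hd.elim hf fun hd => hc (hd.trans (Subgroup.card_dvd_of_le (Subgroup.map_comap_le f K)))
  · obtain ⟨k, hk⟩ := hq (f g)
    exact ⟨k, by simpa using hk⟩

/-- A central extension of a `p`-nilpotent group by a `p`-group is `p`-nilpotent. Let `K` be the
preimage of the normal `p'`-subgroup `K'` and `m` the order of `K'`. The index of the centre of `K`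
divides `m`, so `x ↦ x ^ m` is an endomorphism of `K` by transfer, and its kernel is the required
normal `p'`-subgroup. -/
theorem IsPNilpotent.of_ker_central [hp : Fact p.Prime] [Finite G] {G' : Type*} [Group G']
    (h : IsPNilpotent p G') (f : G →* G') (hZ : f.ker ≤ Subgroup.center G)
    (hf : IsPGroup p f.ker) : IsPNilpotent p G := by
  rw [isPNilpotent_iff] at *
  obtain ⟨K', hK', hc, hq⟩ := h
  set K : Subgroup G := K'.comap f with hKdef
  set m := Nat.card K' with hm
  have hcenter : (Subgroup.center K).index ∣ m := by
    have h1 : f.ker.subgroupOf K ≤ Subgroup.center K := fun z hz =>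
      Subgroup.mem_center_iff.2 fun g => Subtype.ext (Subgroup.mem_center_iff.1 (hZ hz) g)
    refine (Subgroup.index_dvd_of_le h1).trans ?_
    change f.ker.relIndex K ∣ m
    rw [Subgroup.relIndex_ker]
    exact Subgroup.card_dvd_of_le (Subgroup.map_comap_le f K')
  have hpow : ∀ x ∈ K, x ^ m ∈ f.ker := fun x hx => by
    rw [MonoidHom.mem_ker, map_pow]
    exact congrArg Subtype.val (pow_card_eq_one' (x := (⟨f x, hx⟩ : K')))
  have hmul : ∀ x ∈ K, ∀ y ∈ K, (x * y) ^ m = x ^ m * y ^ m := fun x hx y hy => by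
    obtain ⟨c, hcm⟩ := hcenter
    have h1 : ∀ z : K, ((MonoidHom.transferCenterPow K z : Subgroup.center K) : K) ^ c = z ^ m :=
      fun z => by rw [MonoidHom.transferCenterPow_apply, ← pow_mul, ← hcm]
    have h2 : ((⟨x, hx⟩ : K) * ⟨y, hy⟩) ^ m = (⟨x, hx⟩ : K) ^ m * (⟨y, hy⟩ : K) ^ m := by
      rw [← h1, ← h1, ← h1, map_mul, Subgroup.coe_mul, Commute.mul_pow]
      exact (Subgroup.mem_center_iff.1 (MonoidHom.transferCenterPow K ⟨y, hy⟩).2 _)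
    exact congrArg Subtype.val h2
  let Q : Subgroup G :=
    { carrier := {x | x ∈ K ∧ x ^ m = 1}
      one_mem' := ⟨K.one_mem, one_pow m⟩
      mul_mem' := fun {x y} hx hy =>
        ⟨K.mul_mem hx.1 hy.1, by rw [hmul x hx.1 y hy.1, hx.2, hy.2, one_mul]⟩
      inv_mem' := fun {x} hx => ⟨K.inv_mem hx.1, by rw [inv_pow, hx.2, inv_one]⟩ }
  refine ⟨Q, ⟨fun x hx g => ⟨Subgroup.Normal.conj_mem inferInstance x hx.1 g, ?_⟩⟩,
    fun hd => ?_, fun g => ?_⟩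
  · rw [conj_pow, hx.2, mul_one, mul_inv_cancel]
  · obtain ⟨x, hx⟩ := exists_prime_orderOf_dvd_card' p hd
    exact hc (hx ▸ orderOf_dvd_of_pow_eq_one (Subtype.ext x.2.2))
  · obtain ⟨k, hk⟩ := hq (f g)
    have hk' : g ^ p ^ k ∈ K := by rw [hKdef, Subgroup.mem_comap, map_pow]; exact hk
    obtain ⟨j, hj⟩ := hf ⟨_, hpow _ hk'⟩
    refine ⟨k + j, ?_, ?_⟩
    · rw [pow_add, pow_mul]
      exact K.pow_mem hk' _
    · rw [pow_add, pow_mul, pow_right_comm]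
      exact congrArg Subtype.val hj

theorem card_quotient_lt [Finite G] {N : Subgroup G} (hN : N ≠ ⊥) :
    Nat.card (G ⧸ N) < Nat.card G := by
  rw [N.card_eq_card_quotient_mul_card_subgroup]
  exact lt_mul_of_one_lt_right Nat.card_pos (N.one_lt_card_iff_ne_bot.2 hN)

/-- The automorphism group of a group of prime order is abelian, so commutators act trivially. -/
theorem commute_of_card_prime [hp : Fact p.Prime] {N : Subgroup G} [N.Normal]
    (hN : Nat.card N = p) {c : G} (hc : c ∈ commutator G) {n : G} (hn : n ∈ N) :
    c * n = n * c := by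
  have : IsCyclic N := isCyclic_of_prime_card hN
  have hle : commutator G ≤ (MulAut.conjNormal : G →* MulAut N).ker := by
    rw [commutator_def, Subgroup.commutator_le]
    intro g _ h _
    rw [MonoidHom.mem_ker, map_commutatorElement, commutatorElement_eq_one_iff_mul_comm]
    obtain ⟨k, hk⟩ := MonoidHom.map_cyclic (MulAut.conjNormal g : MulAut N).toMonoidHom
    ext1 x
    have hk' : ∀ x : N, (MulAut.conjNormal g : MulAut N) x = x ^ k := hk
    rw [MulAut.mul_apply, MulAut.mul_apply, hk', hk', map_zpow]
  have h1 := DFunLike.congr_fun (MonoidHom.mem_ker.1 (hle hc)) (⟨n, hn⟩ : N)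
  have h2 := congrArg Subtype.val h1
  rw [MulAut.conjNormal_apply] at h2
  exact mul_inv_eq_iff_eq_mul.1 h2

/-- Let `N` be a minimal normal subgroup of `G`. The derived subgroup maps to that of `G ⧸ N` with
kernel inside `N`; the kernel is a `p'`-group, or it has order dividing `p` and is central in the
derived subgroup. -/
theorem IsPSupersoluble.isPNilpotent_commutator [hp : Fact p.Prime] [Finite G]
    (h : IsPSupersoluble p G) : IsPNilpotent p (commutator G) := by
  induction hn : Nat.card G using Nat.strong_induction_on generalizing G with
  | _ n ih =>
  rcases subsingleton_or_nontrivial G with hG | hG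
  · refine isPNilpotent_iff.2 ⟨⊥, inferInstance, ?_, fun g => ⟨0, ?_⟩⟩
    · simpa using hp.out.one_lt.ne'
    · rw [Subsingleton.elim (g ^ _) 1]
      exact Subgroup.one_mem _
  · obtain ⟨N, -, hN⟩ := exists_minimal_normal (G := G) (N := ⊤) inferInstance top_ne_bot
    have := hN.normal_top
    have hq := ih (Nat.card (G ⧸ N)) (hn ▸ card_quotient_lt hN.lt.ne')
      (h.of_surjective _ (QuotientGroup.mk'_surjective N)) rfl
    let f : commutator G →* commutator (G ⧸ N) :=
      ((QuotientGroup.mk' N).comp (commutator G).subtype).codRestrict _ fun x => by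
        rw [commutator_def, ← Subgroup.map_top_of_surjective _ (QuotientGroup.mk'_surjective N),
          ← Subgroup.map_commutator]
        exact Subgroup.mem_map_of_mem _ x.2
    have hker : ∀ x ∈ f.ker, (x : G) ∈ N := fun x hx =>
      (QuotientGroup.eq_one_iff (x : G)).1 (congrArg Subtype.val (MonoidHom.mem_ker.1 hx))
    have hcard : Nat.card f.ker ∣ Nat.card N := by
      rw [← Subgroup.card_map_of_injective (commutator G).subtype_injective]
      exact Subgroup.card_dvd_of_le (Subgroup.map_le_iff_le_comap.2 hker)
    rcases h.card_eq_or hN with hc | hc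
    · refine hq.of_ker_central f (fun x hx => Subgroup.mem_center_iff.2 fun g => Subtype.ext ?_) ?_
      · exact commute_of_card_prime hc g.2 (hker x hx)
      · exact IsPGroup.of_card_dvd_pow (n := 1) (by rwa [pow_one, ← hc])
    · exact hq.of_ker_coprime f fun hd => hc (hd.trans hcard)

/-- The normal `p'`-subgroup in the definition of a `p`-nilpotent group consists of all elements of
order prime to `p`, hence is characteristic. -/
theorem IsPNilpotent.exists_characteristic [hp : Fact p.Prime] [Finite G]
    (h : IsPNilpotent p G) :
    ∃ K : Subgroup G, K.Characteristic ∧ ¬ p ∣ Nat.card K ∧ ∀ g : G, ∃ k : ℕ, g ^ p ^ k ∈ K := by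
  obtain ⟨K, hK, hc, hq⟩ := isPNilpotent_iff.1 h
  have hmem : ∀ x : G, ¬ p ∣ orderOf x → x ∈ K := fun x hx => by
    obtain ⟨k, hk⟩ := hq x
    have hcop : (orderOf x).Coprime (p ^ k) :=
      (((hp.out.coprime_iff_not_dvd).2 hx).pow_left k).symm
    obtain ⟨j, hj⟩ := exists_pow_eq_self_of_coprime hcop.symm
    exact hj ▸ K.pow_mem hk j
  refine ⟨K, Subgroup.characteristic_iff_le_comap.2 fun φ x hx => hmem _ fun hd => hc ?_, hc, hq⟩
  have h1 : orderOf (φ.toMonoidHom x) = orderOf x := φ.orderOf_eq x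
  exact (h1 ▸ hd).trans (K.orderOf_dvd_natCard hx)

end PNilpotent

/-! ### Residuals -/

section Residual

variable {p : ℕ} {G : Type u} [Group G]

/-- A class of groups containing the trivial groups and closed under subdirect products has
residuals. -/
theorem exists_isResidual [Finite G] {𝔉 : ∀ (X : Type u) [Group X], Prop}
    (htop : 𝔉 (G ⧸ (⊤ : Subgroup G)))
    (hinf : ∀ (M N : Subgroup G) [M.Normal] [N.Normal],
      𝔉 (G ⧸ M) → 𝔉 (G ⧸ N) → 𝔉 (G ⧸ M ⊓ N)) :
    ∃ R : Subgroup G, IsResidual 𝔉 R := by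
  obtain ⟨R, hR⟩ := Set.Finite.exists_minimal
    (s := {N : Subgroup G | ∃ _ : N.Normal, 𝔉 (G ⧸ N)}) (Set.toFinite _) ⟨⊤, inferInstance, htop⟩
  obtain ⟨hRn, hRF⟩ := hR.prop
  refine ⟨R, hRn, hRF, fun N hN h => ?_⟩
  exact (hR.le_of_le ⟨inferInstance, hinf R N hRF h⟩ inf_le_left).trans inf_le_right

theorem exists_isResidual_isPSupersoluble [Finite G] :
    ∃ R : Subgroup G, IsResidual (fun X _ => IsPSupersoluble p X) R := by
  refine exists_isResidual (fun K H h _ => ?_) fun M N _ _ hM hN => hM.quotient_inf hN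
  have : Subsingleton (G ⧸ (⊤ : Subgroup G)) := QuotientGroup.subsingleton_quotient_top
  exact absurd (Subsingleton.elim K H) h.lt.ne

theorem exists_isResidual_isPNilpotent [hp : Fact p.Prime] [Finite G] :
    ∃ R : Subgroup G, IsResidual (fun X _ => IsPNilpotent p X) R := by
  refine exists_isResidual ⟨⊥, inferInstance, ?_, ?_⟩ fun M N _ _ hM hN => hM.quotient_inf hN
  · simpa using hp.out.one_lt.ne'
  · have : Subsingleton (G ⧸ (⊤ : Subgroup G)) := QuotientGroup.subsingleton_quotient_top
    have := (QuotientGroup.mk'_surjective (⊥ : Subgroup (G ⧸ (⊤ : Subgroup G)))).subsingleton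
    exact IsPGroup.of_subsingleton _ _

theorem IsResidual.le_ker {R : Subgroup G} (hR : IsResidual (fun X _ => IsPNilpotent p X) R)
    {G' : Type*} [Group G'] (h : IsPNilpotent p G') (f : G →* G') : R ≤ f.ker :=
  hR.2.2 _ inferInstance (h.quotient_ker f)

theorem IsResidual.characteristic {R : Subgroup G}
    (hR : IsResidual (fun X _ => IsPNilpotent p X) R) : R.Characteristic := by
  obtain ⟨hn, hF, -⟩ := id hR
  refine Subgroup.characteristic_iff_le_comap.2 fun φ => ?_
  have h := hR.le_ker hF ((QuotientGroup.mk' R).comp φ.toMonoidHom)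
  rwa [← MonoidHom.comap_ker, QuotientGroup.ker_mk'] at h

end Residual

/-! ### Products of permuting subgroups -/

section Permuting

variable {G : Type u} [Group G]

theorem mem_sup_iff_of_mul_comm {A V : Subgroup G} (h : (A : Set G) * V = V * A) {g : G} :
    g ∈ A ⊔ V ↔ ∃ v ∈ V, ∃ a ∈ A, v * a = g := by
  constructor
  · let S : Subgroup G :=
      { carrier := (V : Set G) * A
        one_mem' := ⟨1, V.one_mem, 1, A.one_mem, mul_one 1⟩
        mul_mem' := by
          rintro _ _ ⟨v, hv, a, ha, rfl⟩ ⟨w, hw, b, hb, rfl⟩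
          obtain ⟨w', hw', a', ha', he⟩ : a * w ∈ (V : Set G) * A := h ▸ ⟨a, ha, w, hw, rfl⟩
          refine ⟨v * w', V.mul_mem hv hw', a' * b, A.mul_mem ha' hb, ?_⟩
          have he' : w' * a' = a * w := he
          change v * w' * (a' * b) = v * a * (w * b)
          rw [mul_assoc, ← mul_assoc w', he', mul_assoc, mul_assoc]
        inv_mem' := by
          rintro _ ⟨v, hv, a, ha, rfl⟩
          rw [← h]
          exact ⟨a⁻¹, A.inv_mem ha, v⁻¹, V.inv_mem hv, (mul_inv_rev v a).symm⟩ }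
    have hS : A ⊔ V ≤ S := sup_le (fun a ha => ⟨1, V.one_mem, a, ha, one_mul a⟩)
      fun v hv => ⟨v, hv, 1, A.one_mem, mul_one v⟩
    exact fun hg => hS hg
  · rintro ⟨v, hv, a, ha, rfl⟩
    exact Subgroup.mul_mem _ (Subgroup.mem_sup_right hv) (Subgroup.mem_sup_left ha)

theorem relIndex_eq_of_forall_mul {A X H : Subgroup G} (hX : X ≤ H)
    (h : ∀ g ∈ H, ∃ x ∈ X, ∃ a ∈ A, x * a = g) : A.relIndex X = A.relIndex H := by
  refine Nat.card_congr (Equiv.ofBijective (Subgroup.quotientSubgroupOfEmbeddingOfLE A hX)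
    ⟨(Subgroup.quotientSubgroupOfEmbeddingOfLE A hX).injective, fun y => ?_⟩)
  obtain ⟨⟨g, hg⟩, rfl⟩ := QuotientGroup.mk_surjective y
  obtain ⟨x, hx, a, ha, rfl⟩ := h g hg
  refine ⟨QuotientGroup.mk ⟨x, hx⟩, ?_⟩
  rw [Subgroup.quotientSubgroupOfEmbeddingOfLE_apply_mk, QuotientGroup.eq, Subgroup.mem_subgroupOf]
  simpa using ha

/-- Take `K` maximal among the normal subgroups of `G` with `DK ∩ E = D`, and a chief factor
`H / K`. Then the index of `D` in `DH ∩ E` is a nontrivial power of `p` dividing `|H / K|`. -/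
theorem IsPSupersoluble.exists_relIndex_eq {p : ℕ} [hp : Fact p.Prime] [Finite G]
    (h : IsPSupersoluble p G) {D E : Subgroup G} (hDE : D < E) {n : ℕ}
    (hn : D.relIndex E = p ^ n) : ∃ X, D ≤ X ∧ X ≤ E ∧ D.relIndex X = p := by
  obtain ⟨K, hK⟩ := Set.Finite.exists_maximal
    (s := {K : Subgroup G | K.Normal ∧ (D ⊔ K) ⊓ E ≤ D}) (Set.toFinite _)
    ⟨⊥, inferInstance, by rw [sup_bot_eq]; exact inf_le_left⟩
  have hKn := hK.prop.1
  have htop : K < ⊤ := lt_top_iff_ne_top.2 fun he => hDE.not_ge (by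
    have := hK.prop.2
    rwa [he, sup_top_eq, top_inf_eq] at this)
  obtain ⟨H, hH⟩ := Set.Finite.exists_minimal
    (s := {H : Subgroup G | H.Normal ∧ K < H}) (Set.toFinite _) ⟨⊤, inferInstance, htop⟩
  have hHn := hH.prop.1
  have hKH : IsChiefFactor K H := by
    refine ⟨hKn, hHn, hH.prop.2, fun N hN hKN hNH => ?_⟩
    rcases hKN.eq_or_lt with he | hlt
    · exact Or.inl he.symm
    · exact Or.inr (le_antisymm hNH (hH.le_of_le ⟨hN, hlt⟩ hNH))
  have hnot : ¬ (D ⊔ H) ⊓ E ≤ D := fun hle => hKH.lt.not_ge (hK.le_of_ge ⟨hHn, hle⟩ hKH.lt.le)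
  set X := (D ⊔ H) ⊓ E with hX
  have hDX : D ≤ X := le_inf le_sup_left hDE.le
  have hcap : (D ⊔ K) ⊓ X = D := by
    refine le_antisymm ?_ (le_inf le_sup_left hDX)
    exact (inf_le_inf_left _ inf_le_right).trans hK.prop.2
  have h1 : D.relIndex X = (D ⊔ K).relIndex (X ⊔ K) := by
    rw [← relIndex_eq_of_forall_mul (A := D ⊔ K) (X := X) (H := X ⊔ K) le_sup_left,
      ← Subgroup.inf_relIndex_right (D ⊔ K), hcap]
    intro g hg
    obtain ⟨x, hx, k, hk, rfl⟩ := Subgroup.mem_sup_of_normal_right.1 hg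
    exact ⟨x, hx, k, Subgroup.mem_sup_right hk, rfl⟩
  have h2 : (D ⊔ K).relIndex (X ⊔ K) ∣ (D ⊔ K).relIndex (D ⊔ H) :=
    Dvd.intro _ (Subgroup.relIndex_mul_relIndex _ _ _ (sup_le_sup_right hDX K)
      (sup_le inf_le_left (hKH.lt.le.trans le_sup_right)))
  have h3 : (D ⊔ K).relIndex (D ⊔ H) = (D ⊔ K).relIndex H := by
    refine (relIndex_eq_of_forall_mul le_sup_right fun g hg => ?_).symm
    obtain ⟨x, hx, d, hd, rfl⟩ := Subgroup.mem_sup_of_normal_left.1 (sup_comm D H ▸ hg)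
    exact ⟨x, hx, d, Subgroup.mem_sup_left hd, rfl⟩
  have h4 : D.relIndex X ∣ K.relIndex H :=
    h1 ▸ h2.trans (h3 ▸ Subgroup.relIndex_dvd_of_le_left H le_sup_right)
  have h5 : D.relIndex X ∣ p ^ n :=
    hn ▸ Dvd.intro _ (Subgroup.relIndex_mul_relIndex D X E hDX inf_le_right)
  have h6 : p ∣ D.relIndex X := by
    obtain ⟨k, -, hk⟩ := (Nat.dvd_prime_pow hp.out).1 h5
    rw [hk]
    refine dvd_pow_self p fun h0 => hnot (Subgroup.relIndex_eq_one.1 ?_)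
    rw [hk, h0, pow_zero]
  have h7 := h K H hKH (h6.trans h4)
  exact ⟨X, hDX, inf_le_right, Nat.dvd_antisymm (h7 ▸ h4) h6⟩

end Permuting

/-! ### Minimal normal subgroups of mutually permutable products -/

section Mutually

variable {p : ℕ} {G : Type u} [Group G] {A B N : Subgroup G}

theorem IsMutuallyPermutableProduct.exists_mul (h : IsMutuallyPermutableProduct A B) (g : G) :
    ∃ a ∈ A, ∃ b ∈ B, a * b = g :=
  Set.mem_mul.1 (h.mul_eq_univ ▸ Set.mem_univ g)

theorem IsMutuallyPermutableProduct.symm (h : IsMutuallyPermutableProduct A B) :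
    IsMutuallyPermutableProduct B A :=
  ⟨(h.left_permutes A le_rfl).symm.trans h.mul_eq_univ,
    fun V hV => (h.right_permutes V hV).symm, fun U hU => (h.left_permutes U hU).symm⟩

theorem IsMutuallyPermutableProduct.map (h : IsMutuallyPermutableProduct A B)
    {G' : Type*} [Group G'] {f : G →* G'} (hf : Function.Surjective f) :
    IsMutuallyPermutableProduct (A.map f) (B.map f) := by
  have himage : ∀ {C : Subgroup G} {U : Subgroup G'}, U ≤ C.map f →
      (U.comap f ⊓ C).map f = U := by
    intro C U hU
    refine le_antisymm (Subgroup.map_le_iff_le_comap.2 inf_le_left) fun x hx => ?_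
    obtain ⟨c, hc, rfl⟩ := hU hx
    exact ⟨c, ⟨hx, hc⟩, rfl⟩
  refine ⟨?_, fun U hU => ?_, fun V hV => ?_⟩
  · rw [Subgroup.coe_map, Subgroup.coe_map, ← Set.image_mul, h.mul_eq_univ, Set.image_univ,
      hf.range_eq]
  · rw [← himage hU, Subgroup.coe_map, Subgroup.coe_map, ← Set.image_mul,
      h.left_permutes _ inf_le_right, Set.image_mul]
  · rw [← himage hV, Subgroup.coe_map, Subgroup.coe_map, ← Set.image_mul,
      h.right_permutes _ inf_le_right, Set.image_mul]

theorem IsMutuallyPermutableProduct.normal (h : IsMutuallyPermutableProduct A B)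
    {M : Subgroup G} (hA : ∀ a ∈ A, ∀ m ∈ M, a * m * a⁻¹ ∈ M)
    (hB : ∀ b ∈ B, ∀ m ∈ M, b * m * b⁻¹ ∈ M) : M.Normal := by
  refine ⟨fun m hm g => ?_⟩
  obtain ⟨a, ha, b, hb, rfl⟩ := h.exists_mul g
  have := hA a ha _ (hB b hb m hm)
  simpa only [mul_inv_rev, mul_assoc] using this

theorem IsMutuallyPermutableProduct.normal_commutator (h : IsMutuallyPermutableProduct A B) :
    (⁅A, B⁆ : Subgroup G).Normal :=
  h.normal
    (fun _ ha m hm => (Subgroup.mem_normalizer_iff.1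
      (Subgroup.normalizer_commutator_ge_left A B ha) m).1 hm)
    fun _ hb m hm => (Subgroup.mem_normalizer_iff.1
      (Subgroup.normalizer_commutator_ge_right A B hb) m).1 hm

/-- A normal `p`-subgroup `N ≠ 1` contains a subgroup of order `p` normalised by `A`. If
`A ∩ N ≠ 1`, a minimal normal subgroup of `A` inside `A ∩ N` will do. Otherwise `V ↦ AV ∩ N` turns
subgroups between `A ∩ B` and `AN ∩ B` into `A`-invariant subgroups of `N`, with `|AV ∩ N|` the
index of `A ∩ B` in `V`, so a `V` in which `A ∩ B` has index `p` is wanted. -/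
theorem IsMutuallyPermutableProduct.exists_invariant_card_eq [hp : Fact p.Prime] [Finite G]
    (h : IsMutuallyPermutableProduct A B) (hA : IsPSupersoluble p A) (hB : IsPSupersoluble p B)
    [hN : N.Normal] (hNp : IsPGroup p N) (hne : N ≠ ⊥) :
    ∃ M ≤ N, Nat.card M = p ∧ ∀ a ∈ A, ∀ m ∈ M, a * m * a⁻¹ ∈ M := by
  by_cases hAN : A ⊓ N = ⊥
  · have hcard : ∀ V ≤ B, V ≤ A ⊔ N → A.relIndex V = Nat.card ((A ⊔ V) ⊓ N : Subgroup G) := by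
      intro V hVB hV
      rw [relIndex_eq_of_forall_mul (A := A) (X := V) (H := A ⊔ V) le_sup_right
        fun g hg => (mem_sup_iff_of_mul_comm (h.right_permutes V hVB)).1 hg,
        ← relIndex_eq_of_forall_mul (A := A) (X := (A ⊔ V) ⊓ N) (H := A ⊔ V) inf_le_left,
        ← Subgroup.inf_relIndex_right, inf_left_comm, hAN, inf_bot_eq, Subgroup.relIndex_bot_left]
      intro g hg
      obtain ⟨n, hn, a, ha, rfl⟩ := Subgroup.mem_sup_of_normal_left.1
        (sup_comm A N ▸ sup_le le_sup_left hV hg)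
      exact ⟨n, ⟨(Subgroup.mul_mem_cancel_right _ (Subgroup.mem_sup_left ha)).1 hg, hn⟩,
        a, ha, rfl⟩
    set E := (A ⊔ N) ⊓ B with hE
    have hAE : N ≤ A ⊔ E := fun n hn => by
      obtain ⟨a, ha, b, hb, rfl⟩ := h.exists_mul n
      refine Subgroup.mul_mem _ (Subgroup.mem_sup_left ha) (Subgroup.mem_sup_right ⟨?_, hb⟩)
      exact (Subgroup.mul_mem_cancel_left _ (Subgroup.mem_sup_left ha)).1
        (Subgroup.mem_sup_right hn)
    have hEN : A.relIndex E = Nat.card N := by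
      rw [hcard E inf_le_right inf_le_left, inf_eq_right.2 hAE]
    have hidx : (A.subgroupOf B).relIndex (E.subgroupOf B) = Nat.card N :=
      (Subgroup.relIndex_subgroupOf inf_le_right).trans hEN
    obtain ⟨n, hn⟩ := IsPGroup.iff_card.1 hNp
    have hlt : A.subgroupOf B < E.subgroupOf B := by
      refine lt_of_le_of_ne (fun x hx => ⟨Subgroup.mem_sup_left hx, x.2⟩) fun he => hne ?_
      rw [he, Subgroup.relIndex_self] at hidx
      exact Subgroup.card_eq_one.1 hidx.symm
    obtain ⟨X, -, hXE, hX⟩ := hB.exists_relIndex_eq hlt (hidx.trans hn)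
    have hXE' : X.map B.subtype ≤ E := Subgroup.map_le_iff_le_comap.2 hXE
    refine ⟨(A ⊔ X.map B.subtype) ⊓ N, inf_le_right, ?_, fun a ha m hm => ⟨?_, ?_⟩⟩
    · rw [← hcard _ (Subgroup.map_subtype_le X) (hXE'.trans inf_le_left), ← hX]
      exact (Subgroup.relIndex_comap A B.subtype X).symm
    · exact Subgroup.mul_mem _ (Subgroup.mul_mem _ (Subgroup.mem_sup_left ha) hm.1)
        (Subgroup.inv_mem _ (Subgroup.mem_sup_left ha))
    · exact hN.conj_mem m hm.2 a
  · obtain ⟨M, hMN, hM⟩ := exists_minimal_normal (N := N.subgroupOf A) inferInstance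
      (fun he => hAN (by
        rw [inf_comm]
        exact disjoint_iff.1 (Subgroup.subgroupOf_eq_bot.1 he)))
    have hMp : IsPGroup p M := (hNp.comap_subtype (K := A)).to_le hMN
    have hMcard : Nat.card (M.map A.subtype) = Nat.card M :=
      Subgroup.card_map_of_injective A.subtype_injective
    refine ⟨M.map A.subtype, Subgroup.map_le_iff_le_comap.2 hMN, ?_, ?_⟩
    · rw [hMcard]
      refine (hA.card_eq_or hM).resolve_right fun hnd => ?_
      have : Nontrivial M := (Subgroup.nontrivial_iff_ne_bot M).2 hM.lt.ne'
      exact hnd (hMp.card_eq_or_dvd.resolve_left Finite.one_lt_card.ne')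
    · rintro a ha _ ⟨m, hm, rfl⟩
      exact ⟨_, hM.normal_top.conj_mem m hm ⟨a, ha⟩, rfl⟩

/-- Suppose that `[A, B]` centralises the abelian minimal normal subgroup `N`. If `A` normalises a
subgroup of order `p` of `N`, on which it acts by powers, then the elements of `N` on which it acts
by the same powers form a normal subgroup of `G`, because `A` and `B` act on `N` as commuting
groups. So `A` acts on `N` by powers. -/
theorem IsMutuallyPermutableProduct.exists_conj_eq_zpow [hp : Fact p.Prime]
    (h : IsMutuallyPermutableProduct A B) (hN : IsChiefFactor ⊥ N)
    (hcomm : ∀ m ∈ N, ∀ n ∈ N, m * n = n * m)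
    (hcent : ∀ c ∈ ⁅A, B⁆, ∀ n ∈ N, c * n = n * c)
    {M : Subgroup G} (hMN : M ≤ N) (hM : Nat.card M = p)
    (hinv : ∀ a ∈ A, ∀ m ∈ M, a * m * a⁻¹ ∈ M) :
    ∀ a ∈ A, ∃ k : ℤ, ∀ n ∈ N, a * n * a⁻¹ = n ^ k := by
  have hNn := hN.normal_top
  have : IsCyclic M := isCyclic_of_prime_card hM
  have hex : ∀ a : A, ∃ k : ℤ, ∀ m ∈ M, (a : G) * m * (a : G)⁻¹ = m ^ k := by
    rintro ⟨a, ha⟩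
    obtain ⟨k, hk⟩ := MonoidHom.map_cyclic
      (((MulAut.conj a).toMonoidHom.comp M.subtype).codRestrict M fun m => hinv a ha m m.2)
    exact ⟨k, fun m hm => congrArg Subtype.val (hk ⟨m, hm⟩)⟩
  choose k hk using hex
  let C : Subgroup G :=
    { carrier := {x | x ∈ N ∧ ∀ a : A, (a : G) * x * (a : G)⁻¹ = x ^ k a}
      one_mem' := ⟨N.one_mem, fun a => by simp⟩
      mul_mem' := fun {x y} hx hy => ⟨N.mul_mem hx.1 hy.1, fun a => by
        rw [Commute.mul_zpow (hcomm x hx.1 y hy.1), ← hx.2, ← hy.2, conj_mul]⟩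
      inv_mem' := fun {x} hx => ⟨N.inv_mem hx.1, fun a => by
        rw [inv_zpow, ← hx.2, conj_inv]⟩ }
  have hC : C.Normal := by
    refine h.normal (fun a ha x hx => ?_) fun b hb x hx => ⟨hNn.conj_mem x hx.1 b, fun a => ?_⟩
    · rw [hx.2 ⟨a, ha⟩]
      exact C.zpow_mem hx _
    · have h1 : (a : G) * (b * x * b⁻¹) * (a : G)⁻¹ =
          (a * b * (a : G)⁻¹ * b⁻¹) * (b * (a * x * (a : G)⁻¹) * b⁻¹) *
            (a * b * (a : G)⁻¹ * b⁻¹)⁻¹ := by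
        group
      rw [h1, hcent (a * b * (a : G)⁻¹ * b⁻¹) (Subgroup.commutator_mem_commutator a.2 hb) _
        (hNn.conj_mem _ (hNn.conj_mem x hx.1 _) b), mul_inv_cancel_right, hx.2 a, conj_zpow]
  have hMC : M ≤ C := fun m hm => ⟨hMN hm, fun a => hk a m hm⟩
  have hCN : C = N := by
    refine (hN.eq_or_eq C hC bot_le fun x hx => hx.1).resolve_left fun hb => ?_
    have hMb : M = ⊥ := le_bot_iff.1 (hb ▸ hMC)
    exact hp.out.one_lt.ne' (hM ▸ Subgroup.card_eq_one.2 hMb)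
  exact fun a ha => ⟨k ⟨a, ha⟩, fun n hn => (hCN.ge hn).2 ⟨a, ha⟩⟩

theorem IsMutuallyPermutableProduct.card_chiefFactor_eq [hp : Fact p.Prime] [Finite G]
    (h : IsMutuallyPermutableProduct A B) (hA : IsPSupersoluble p A) (hB : IsPSupersoluble p B)
    (hN : IsChiefFactor ⊥ N) (hNp : IsPGroup p N)
    (hcomm : ∀ m ∈ N, ∀ n ∈ N, m * n = n * m)
    (hcent : ∀ c ∈ ⁅A, B⁆, ∀ n ∈ N, c * n = n * c) : Nat.card N = p := by
  have hNn := hN.normal_top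
  obtain ⟨M, hMN, hM, hMinv⟩ := h.exists_invariant_card_eq hA hB hNp hN.lt.ne'
  obtain ⟨L, hLN, hL, hLinv⟩ := h.symm.exists_invariant_card_eq hB hA hNp hN.lt.ne'
  have hpow := h.exists_conj_eq_zpow hN hcomm hcent hMN hM hMinv
  have hLn : L.Normal := by
    refine h.normal (fun a ha m hm => ?_) hLinv
    obtain ⟨k, hk⟩ := hpow a ha
    rw [hk m (hLN hm)]
    exact L.zpow_mem hm k
  rcases hN.eq_or_eq L hLn bot_le hLN with he | he
  · exact absurd (hL ▸ Subgroup.card_eq_one.2 he) hp.out.one_lt.ne'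
  · rw [← he, hL]

end Mutually

/-! ### Mutually permutable products with `p`-nilpotent mutual commutator -/

section Main

variable {p : ℕ} {G : Type u} [Group G] {A B : Subgroup G}

theorem IsMutuallyPermutableProduct.normal_map_of_commutator_eq_bot
    (h : IsMutuallyPermutableProduct A B) (hbot : ⁅A, B⁆ = (⊥ : Subgroup G)) {M : Subgroup A}
    (hM : M.Normal) : (M.map A.subtype).Normal := by
  refine h.normal ?_ ?_
  · rintro a ha _ ⟨m, hm, rfl⟩
    exact ⟨_, hM.conj_mem m hm ⟨a, ha⟩, rfl⟩
  · rintro b hb _ ⟨m, hm, rfl⟩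
    have hbm := Subgroup.mem_centralizer_iff.1
      (Subgroup.commutator_eq_bot_iff_le_centralizer.1 hbot m.2) b hb
    change b * (m : G) * b⁻¹ ∈ _
    rw [hbm, mul_inv_cancel_right]
    exact ⟨m, hm, rfl⟩

/-- By induction it suffices to find a normal subgroup `N ≠ 1` of `G` that has order `p` or order
prime to `p`. If the normal `p'`-subgroup of `[A, B]` is nontrivial, it is such an `N`. If
`[A, B] = 1`, take a minimal normal subgroup of `A` or of `B`. Otherwise `[A, B] ≠ 1` is a
`p`-group, and a minimal normal subgroup of `G` inside its centre has order `p`. -/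
theorem IsMutuallyPermutableProduct.isPSupersoluble [hp : Fact p.Prime] [Finite G]
    (h : IsMutuallyPermutableProduct A B) (hA : IsPSupersoluble p A) (hB : IsPSupersoluble p B)
    (hL : IsPNilpotent p (⁅A, B⁆ : Subgroup G)) : IsPSupersoluble p G := by
  induction hn : Nat.card G using Nat.strong_induction_on generalizing G with
  | _ n ih =>
  -- The hypotheses pass to quotients, so one good normal subgroup suffices.
  have key : ∀ N : Subgroup G, N.Normal → N ≠ ⊥ → (Nat.card N = p ∨ ¬ p ∣ Nat.card N) →
      IsPSupersoluble p G := by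
    intro N hN hne hc
    have hs := QuotientGroup.mk'_surjective N
    refine (ih _ (hn ▸ card_quotient_lt hne) (h.map hs)
      (hA.of_surjective _ (MonoidHom.subgroupMap_surjective (QuotientGroup.mk' N) A))
      (hB.of_surjective _ (MonoidHom.subgroupMap_surjective (QuotientGroup.mk' N) B)) ?_
      rfl).of_quotient hc
    rw [← Subgroup.map_commutator]
    exact hL.of_surjective _ (MonoidHom.subgroupMap_surjective (QuotientGroup.mk' N) _)
  have hcentral : ∀ {C D : Subgroup G}, IsMutuallyPermutableProduct C D →
      IsPSupersoluble p C → ⁅C, D⁆ = (⊥ : Subgroup G) → C ≠ ⊥ → IsPSupersoluble p G := by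
    intro C D hCD hC hbot hne
    have : Nontrivial C := (Subgroup.nontrivial_iff_ne_bot C).2 hne
    obtain ⟨M, -, hM⟩ := exists_minimal_normal (G := C) (N := ⊤) inferInstance top_ne_bot
    have hcard : Nat.card (M.map C.subtype) = Nat.card M :=
      Subgroup.card_map_of_injective C.subtype_injective
    refine key _ (hCD.normal_map_of_commutator_eq_bot hbot hM.normal_top) (fun he => ?_) ?_
    · exact hM.lt.ne' ((Subgroup.map_eq_bot_iff_of_injective M C.subtype_injective).1 he)
    · rw [hcard]
      exact hC.card_eq_or hM
  have hLn := h.normal_commutator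
  obtain ⟨K, hK, hKc, hKq⟩ := hL.exists_characteristic
  by_cases hKb : K = ⊥
  · have hLp : IsPGroup p (⁅A, B⁆ : Subgroup G) := fun x => by
      obtain ⟨k, hk⟩ := hKq x
      rw [hKb, Subgroup.mem_bot] at hk
      exact ⟨k, hk⟩
    by_cases hbot : ⁅A, B⁆ = (⊥ : Subgroup G)
    · by_cases hAb : A = ⊥
      · by_cases hBb : B = ⊥
        · have : Subsingleton G := subsingleton_of_forall_eq 1 fun g => by
            obtain ⟨a, ha, b, hb, rfl⟩ := h.exists_mul g
            rw [hAb, Subgroup.mem_bot] at ha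
            rw [hBb, Subgroup.mem_bot] at hb
            rw [ha, hb, one_mul]
          exact fun K H hKH _ => absurd (Subsingleton.elim K H) hKH.lt.ne
        · exact hcentral h.symm hB ((Subgroup.commutator_comm B A).trans hbot) hBb
      · exact hcentral h hA hbot hAb
    · -- A minimal normal subgroup of `G` inside the centre of the `p`-group `[A, B]`.
      have hnt : Nontrivial (⁅A, B⁆ : Subgroup G) := (Subgroup.nontrivial_iff_ne_bot _).2 hbot
      have hZ := hLp.center_nontrivial
      obtain ⟨N, hNZ, hN⟩ := exists_minimal_normal
        (N := (Subgroup.center (⁅A, B⁆ : Subgroup G)).map (Subgroup.subtype _)) inferInstance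
        (fun he => (Subgroup.nontrivial_iff_ne_bot _).1 hZ
          ((Subgroup.map_eq_bot_iff_of_injective _ (Subgroup.subtype_injective _)).1 he))
      have hNL : N ≤ ⁅A, B⁆ := hNZ.trans (Subgroup.map_subtype_le _)
      have hcent : ∀ c ∈ ⁅A, B⁆, ∀ n ∈ N, c * n = n * c := by
        intro c hc n hn
        obtain ⟨z, hz, rfl⟩ := hNZ hn
        exact congrArg Subtype.val (Subgroup.mem_center_iff.1 hz ⟨c, hc⟩)
      exact key N hN.normal_top hN.lt.ne' (Or.inl (h.card_chiefFactor_eq hA hB hN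
        (hLp.to_le hNL) (fun m hm n hn => hcent m (hNL hm) n hn) hcent))
  · refine key (K.map (Subgroup.subtype _)) inferInstance (fun he => hKb ?_) (Or.inr ?_)
    · exact (Subgroup.map_eq_bot_iff_of_injective K (Subgroup.subtype_injective _)).1 he
    · rwa [Subgroup.card_map_of_injective (Subgroup.subtype_injective _)]

theorem isPNilpotent_map_mk {L : Subgroup G} {T : Subgroup L} [T.Normal]
    [(T.map L.subtype).Normal] (hT : IsPNilpotent p (L ⧸ T)) :
    IsPNilpotent p (L.map (QuotientGroup.mk' (T.map L.subtype))) := by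
  let f := (QuotientGroup.mk' (T.map L.subtype)).subgroupMap L
  refine hT.of_surjective (QuotientGroup.lift T f fun t ht => Subtype.ext ?_) ?_
  · exact (QuotientGroup.eq_one_iff (t : G)).2 ⟨t, ht, rfl⟩
  · exact QuotientGroup.lift_surjective_of_surjective T f
      (MonoidHom.subgroupMap_surjective _ L) _

end Main

/-! ### Equality of the residuals -/

theorem theorem2 {G : Type u} [Group G] [Finite G] (p : ℕ) [Fact p.Prime] (A B : Subgroup G)
    (hAB : IsMutuallyPermutableProduct A B)
    (hA : IsPSupersoluble p A) (hB : IsPSupersoluble p B) :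
    ∃ (R : Subgroup G) (S : Subgroup (commutator G)) (T : Subgroup (⁅A, B⁆ : Subgroup G)),
      IsResidual (fun X _ => IsPSupersoluble p X) R ∧
      IsResidual (fun X _ => IsPNilpotent p X) S ∧
      IsResidual (fun X _ => IsPNilpotent p X) T ∧
      R = S.map (commutator G).subtype ∧
      R = T.map (⁅A, B⁆ : Subgroup G).subtype := by
  obtain ⟨R, hR⟩ := exists_isResidual_isPSupersoluble (p := p) (G := G)
  obtain ⟨S, hS⟩ := exists_isResidual_isPNilpotent (p := p) (G := commutator G)
  obtain ⟨T, hT⟩ := exists_isResidual_isPNilpotent (p := p) (G := (⁅A, B⁆ : Subgroup G))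
  obtain ⟨hRn, hRF, hRle⟩ := id hR
  obtain ⟨hSn, hSF, -⟩ := id hS
  obtain ⟨hTn, hTF, -⟩ := id hT
  have hLn := hAB.normal_commutator
  have hLG : ⁅A, B⁆ ≤ commutator G := Subgroup.commutator_mono le_top le_top
  have hTchar := hT.characteristic
  -- In the quotient by `T`, the mutual commutator becomes `p`-nilpotent.
  have hRT : R ≤ T.map (⁅A, B⁆ : Subgroup G).subtype := by
    refine hRle _ inferInstance ?_
    have hs := QuotientGroup.mk'_surjective (T.map (⁅A, B⁆ : Subgroup G).subtype)
    refine (hAB.map hs).isPSupersoluble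
      (hA.of_surjective _ (MonoidHom.subgroupMap_surjective _ A))
      (hB.of_surjective _ (MonoidHom.subgroupMap_surjective _ B)) ?_
    rw [← Subgroup.map_commutator]
    exact isPNilpotent_map_mk hTF
  have hTS : T.map (⁅A, B⁆ : Subgroup G).subtype ≤ S.map (commutator G).subtype := by
    rintro _ ⟨t, ht, rfl⟩
    have h1 := hT.le_ker hSF ((QuotientGroup.mk' S).comp (Subgroup.inclusion hLG)) ht
    exact ⟨Subgroup.inclusion hLG t, (QuotientGroup.eq_one_iff _).1 h1, rfl⟩
  -- The derived subgroup of the `p`-supersoluble group `G ⧸ R` is `p`-nilpotent.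
  have hSR : S.map (commutator G).subtype ≤ R := by
    have hle : (commutator G).map (QuotientGroup.mk' R) ≤ commutator (G ⧸ R) := by
      rw [commutator_def, Subgroup.map_commutator, commutator_def]
      exact Subgroup.commutator_mono le_top le_top
    rintro _ ⟨s, hs, rfl⟩
    have h1 := hS.le_ker hRF.isPNilpotent_commutator
      ((Subgroup.inclusion hle).comp ((QuotientGroup.mk' R).subgroupMap _)) hs
    exact (QuotientGroup.eq_one_iff (s : G)).1 (congrArg Subtype.val (MonoidHom.mem_ker.1 h1))
  exact ⟨R, S, T, hR, hS, hT, le_antisymm (hRT.trans hTS) hSR,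
    le_antisymm hRT (hTS.trans hSR)⟩
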